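/- Let $\mathcal A$ be a unital $C^*$-algebra and let $H_{\mathcal A}=\ell^2(\mathcal A)$ be the standard Hilbert $\mathcal A$-module of sequences $x=(x_i)_{i\in\mathbb N}$ in $\mathcal A$ for which $\sum_i x_ix_i^*$ converges in norm, with coordinatewise left multiplication by $\mathcal A$, inner product $\langle x,y\rangle=\sum_i y_ix_i^*$ and norm $\|x\|=\|\langle x,x\rangle\|^{1/2}$ (replacing $\mathcal A$ by its opposite algebra gives the convention with right modules and $\langle x,y\rangle=\sum_i x_i^*y_i$). Let $B^a(H_{\mathcal A})$ be the algebra of all bounded adjointable $\mathcal A$-linear operators on $H_{\mathcal A}$. For $F\in B^a(H_{\mathcal A})$ consider decompositions $$H_{\mathcal A}=M_1\,\tilde\oplus\,N_1\xrightarrow{\;F\;}M_2\,\tilde\oplus\,N_2=H_{\mathcal A}$$ into direct sums (not necessarily orthogonal) of closed submodules such that $F(M_1)\subseteq M_2$, $F(N_1)\subseteq N_2$, and $F|_{M_1}:M_1\to M_2$ is an isomorphism (of topological $\mathcal A$-modules). Let $\mathcal M\Phi_+(H_{\mathcal A})$, $\mathcal M\Phi_-(H_{\mathcal A})$ and $\mathcal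 M\Phi(H_{\mathcal A})$ be the sets of those $F\in B^a(H_{\mathcal A})$ that admit such a decomposition in which, respectively, $N_1$ is finitely generated over $\mathcal A$, $N_2$ is finitely generated over $\mathcal A$, and both $N_1$ and $N_2$ are finitely generated over $\mathcal A$. A two-sided ideal in a multiplicative semigroup $T$ is a (possibly empty) subset $I\subseteq T$ with $ab\in I$ and $ba\in I$ for all $a\in T$, $b\in I$. Then $\mathcal M\Phi_+(H_{\mathcal A})$ and $\mathcal M\Phi_-(H_{\mathcal A})$ are semigroups under multiplication (composition), $\mathcal M\Phi_+(H_{\mathcal A})\setminus\mathcal M\Phi(H_{\mathcal A})$ is a two-sided ideal in $\mathcal M\Phi_+(H_{\mathcal A})$, and $\mathcal M\Phi_-(H_{\mathcal A})\setminus\mathcal M\Phi(H_{\mathcal A})$ is a two-sided ideal in $\mathcal M\Phi_-(H_{\mathcal A})$. In particular, $\mathcal M\Phi_+(H_{\mathcal A})\setminus\mathcal M\Phi(H_{\mathcal A})$ and $\mathcal M\Phi_-(H_{\mathcal A})\setminus\mathcal M\Phi(H_{\mathcal A})$ are closed under multiplication, that is, they are multiplicative semigroups. -/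

import Mathlib

noncomputable section

namespace StandardHilbertModule

section Algebra

variable (A : Type*) [CStarAlgebra A] [PartialOrder A] [StarOrderedRing A]

variable {A} in
/-- A family of elements of a C⋆-algebra squeezed between zero and a summable family is summable. -/
theorem summable_of_nonneg_of_le {f g : ℕ → A} (h0 : ∀ i, 0 ≤ f i) (hfg : ∀ i, f i ≤ g i)
    (hg : Summable g) : Summable f := by
  rw [summable_iff_vanishing_norm] at hg ⊢
  intro ε hε
  obtain ⟨s, hs⟩ := hg ε hε
  exact ⟨s, fun t ht => (CStarAlgebra.norm_le_norm_of_nonneg_of_le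
    (Finset.sum_nonneg fun i _ => h0 i) (Finset.sum_le_sum fun i _ => hfg i)).trans_lt (hs t ht)⟩

/-- The sequences `x` in `A` for which `∑ i, x i * star (x i)` converges in norm. (For series with
positive terms, unconditional convergence and convergence of the partial sums agree.) -/
def l2Submodule : Submodule A (ℕ → A) where
  carrier := {x | Summable fun i => x i * star (x i)}
  zero_mem' := by simp
  add_mem' {x y} hx hy := by
    refine summable_of_nonneg_of_le (fun i => mul_star_self_nonneg _) (fun i => ?_)
      ((hx.add hy).add (hx.add hy))
    have h : 0 ≤ (x i - y i) * star (x i - y i) := mul_star_self_nonneg _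
    rw [← sub_nonneg]
    convert h using 1
    simp only [Pi.add_apply, star_add, star_sub]
    noncomm_ring
  smul_mem' a x hx := by
    have h := (Summable.mul_left a hx).mul_right (star a)
    simpa [mul_assoc] using h

end Algebra

/-- The standard Hilbert C⋆-module `H_A = ℓ²(A)` over a unital C⋆-algebra `A`. Mathlib's convention
for Hilbert C⋆-modules is used: `A` acts by coordinatewise left multiplication, and
`⟪x, y⟫ = ∑ i, y i * star (x i)`. (Replacing `A` by its opposite algebra gives the convention with a
right action and `⟪x, y⟫ = ∑ i, star (x i) * y i`.) The topology is that of the Hilbert module norm,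
defined below, and not the product topology. -/
def HA (A : Type*) [CStarAlgebra A] [PartialOrder A] [StarOrderedRing A] : Type _ :=
  ↥(l2Submodule A)

section Module

variable {A : Type*} [CStarAlgebra A] [PartialOrder A] [StarOrderedRing A]

instance : AddCommGroup (HA A) := inferInstanceAs (AddCommGroup ↥(l2Submodule A))

instance : Module A (HA A) := inferInstanceAs (Module A ↥(l2Submodule A))

instance : Module ℂ (HA A) := inferInstanceAs (Module ℂ ↥(l2Submodule A))

instance : IsScalarTower ℂ A (HA A) := inferInstanceAs (IsScalarTower ℂ A ↥(l2Submodule A))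

instance : CoeFun (HA A) (fun _ => ℕ → A) := ⟨Subtype.val⟩

namespace HA

@[ext] theorem ext {x y : HA A} (h : ∀ i, x i = y i) : x = y := Subtype.ext (funext h)

@[simp] theorem zero_apply (i : ℕ) : (0 : HA A) i = 0 := rfl

@[simp] theorem add_apply (x y : HA A) (i : ℕ) : (x + y) i = x i + y i := rfl

@[simp] theorem smul_apply (a : A) (x : HA A) (i : ℕ) : (a • x) i = a * x i := rfl

@[simp] theorem complex_smul_apply (z : ℂ) (x : HA A) (i : ℕ) : (z • x) i = z • x i := rfl

theorem summable_self (x : HA A) : Summable fun i => x i * star (x i) := x.2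

/-- The series defining the inner product converges, by polarization. -/
theorem summable_inner (x y : HA A) : Summable fun i => y i * star (x i) := by
  have h := ((((y + x).summable_self.sub (y + (-1 : ℂ) • x).summable_self).add
    (((y + Complex.I • x).summable_self.sub
      (y + (-Complex.I) • x).summable_self).const_smul Complex.I))).const_smul ((1 : ℂ) / 4)
  refine h.congr fun i => ?_
  simp only [add_apply, complex_smul_apply, star_add, star_smul, mul_add, add_mul,
    smul_mul_assoc, mul_smul_comm, smul_add, smul_sub, smul_smul, Complex.star_def, map_neg,
    map_one, Complex.conj_I]
  match_scalars <;> (ring_nf; try (rw [Complex.I_sq]; ring))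

/-- The Hilbert module norm `‖x‖ = ‖⟪x, x⟫‖ ^ (1/2)`. -/
instance : Norm (HA A) := ⟨fun x => √‖∑' i, x i * star (x i)‖⟩

instance : CStarModule A (HA A) where
  inner x y := ∑' i, y i * star (x i)
  inner_add_right {x y z} := by
    refine HasSum.tsum_eq ?_
    simpa [add_mul] using (summable_inner x y).hasSum.add (summable_inner x z).hasSum
  inner_self_nonneg {x} := tsum_nonneg fun i => mul_star_self_nonneg (x i)
  inner_self {x} := by
    constructor
    · intro h
      ext i
      have hle := x.summable_self.le_tsum i fun j _ => mul_star_self_nonneg (x j)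
      rw [h] at hle
      exact CStarRing.mul_star_self_eq_zero_iff _ |>.mp (le_antisymm hle (mul_star_self_nonneg _))
    · rintro rfl
      simp
  inner_op_smul_right {a x y} := by
    refine HasSum.tsum_eq ?_
    simpa [mul_assoc] using (summable_inner x y).hasSum.mul_left a
  inner_smul_right_complex {z x y} := by
    refine HasSum.tsum_eq ?_
    simpa using (summable_inner x y).hasSum.const_smul z
  star_inner x y := by
    refine ((summable_inner y x).hasSum.unique ?_).symm
    simpa using (summable_inner x y).hasSum.star
  norm_eq_sqrt_norm_inner_self _ := rfl

theorem inner_def (x y : HA A) : inner A x y = ∑' i, y i * star (x i) := rfl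

theorem hasSum_inner (x y : HA A) : HasSum (fun i => y i * star (x i)) (inner A x y) :=
  (summable_inner x y).hasSum

instance : NormedAddCommGroup (HA A) :=
  NormedAddCommGroup.ofCore (𝕜 := ℂ) (CStarModule.normedSpaceCore A)

instance : NormedSpace ℂ (HA A) := .ofCore (CStarModule.normedSpaceCore A)

end HA

end Module

section Operators

variable (A : Type*) [CStarAlgebra A] [PartialOrder A] [StarOrderedRing A]

/-- The bounded adjointable operators `Bᵃ(H_A)`: the bounded `A`-linear operators `F` on `H_A` for
which there is a bounded `A`-linear `G` with `⟪F x, y⟫ = ⟪x, G y⟫`; multiplication is composition. -/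
def Ba : Subring (HA A →L[A] HA A) where
  carrier := {F | ∃ G : HA A →L[A] HA A, ∀ x y : HA A, (inner A (F x) y : A) = inner A x (G y)}
  one_mem' := ⟨1, fun _ _ => rfl⟩
  zero_mem' := ⟨0, fun _ _ => by simp⟩
  add_mem' := by
    rintro F₁ F₂ ⟨G₁, h₁⟩ ⟨G₂, h₂⟩
    exact ⟨G₁ + G₂, fun x y => by simp [h₁, h₂]⟩
  neg_mem' := by
    rintro F ⟨G, h⟩
    exact ⟨-G, fun x y => by simp [h]⟩
  mul_mem' := by
    rintro F₁ F₂ ⟨G₁, h₁⟩ ⟨G₂, h₂⟩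
    exact ⟨G₂ * G₁, fun x y => by simp [h₁, h₂]⟩

variable {A}

/-- `H_A = M₁ ⊕ N₁` and `H_A = M₂ ⊕ N₂` are (not necessarily orthogonal) direct sum decompositions
into closed submodules with respect to which `F` has the block diagonal matrix `diag(F₁, F₄)`, with
`F₁ : M₁ → M₂` an isomorphism. -/
structure IsDiagonalDecomposition (F : HA A →L[A] HA A) (M₁ N₁ M₂ N₂ : Submodule A (HA A)) :
    Prop where
  isClosed_M₁ : IsClosed (M₁ : Set (HA A))
  isClosed_N₁ : IsClosed (N₁ : Set (HA A))
  isClosed_M₂ : IsClosed (M₂ : Set (HA A))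
  isClosed_N₂ : IsClosed (N₂ : Set (HA A))
  isCompl_domain : IsCompl M₁ N₁
  isCompl_range : IsCompl M₂ N₂
  exists_iso : ∃ F₁ : M₁ ≃L[A] M₂, ∀ x : M₁, F x = F₁ x
  map_N₁ : ∀ x ∈ N₁, F x ∈ N₂

variable (A)

/-- The upper semi-`A`-Fredholm operators `MΦ₊(H_A)`. -/
def MPhiPlus : Set (Ba A) :=
  {F | ∃ M₁ N₁ M₂ N₂ : Submodule A (HA A),
    IsDiagonalDecomposition (F : HA A →L[A] HA A) M₁ N₁ M₂ N₂ ∧ N₁.FG}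

/-- The lower semi-`A`-Fredholm operators `MΦ₋(H_A)`. -/
def MPhiMinus : Set (Ba A) :=
  {F | ∃ M₁ N₁ M₂ N₂ : Submodule A (HA A),
    IsDiagonalDecomposition (F : HA A →L[A] HA A) M₁ N₁ M₂ N₂ ∧ N₂.FG}

/-- The `A`-Fredholm operators `MΦ(H_A)`. -/
def MPhi : Set (Ba A) :=
  {F | ∃ M₁ N₁ M₂ N₂ : Submodule A (HA A),
    IsDiagonalDecomposition (F : HA A →L[A] HA A) M₁ N₁ M₂ N₂ ∧ N₁.FG ∧ N₂.FG}

end Operators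

section Semigroups

variable {S : Type*} [Mul S]

/-- The set `T` is a semigroup under the multiplication of `S`. -/
def IsMulSemigroup (T : Set S) : Prop := ∀ a ∈ T, ∀ b ∈ T, a * b ∈ T

/-- The set `I` is a two-sided ideal in the multiplicative semigroup `T`. -/
structure IsTwoSidedIdealIn (I T : Set S) : Prop where
  isMulSemigroup : IsMulSemigroup T
  subset : I ⊆ T
  mul_mem_left : ∀ a ∈ T, ∀ b ∈ I, a * b ∈ I
  mul_mem_right : ∀ a ∈ I, ∀ b ∈ T, a * b ∈ I

end Semigroups

end StandardHilbertModule

end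

/-!
An operator `F` is upper (lower) semi-Fredholm exactly when it is left (right) invertible modulo the
ideal of operators of finite `A`-rank, and Fredholm exactly when it is invertible modulo this ideal.
In any monoid, an element that is left but not two-sided invertible stays so when multiplied on
either side by a left invertible one, whence the ideal property.

The difficulty is that the skew projections of a decomposition need not be adjointable. From a
decomposition with `N₁` finitely generated, take an adjointable `S` of finite rank with range `N₁`.
The positive operator `F⋆F + SS⋆` is bounded below, hence invertible, and so `F⋆F`, which differs
from it by a finite rank operator, is invertible modulo finite rank. Conversely, if `1 - LF` has
finite rank, then `(1 - LF)(1 - P)` is small for a large coordinate projection `P`; this turns `L`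
into some `G` with `GFG = G` and `1 - GF` of finite rank, and `F` is diagonal with respect to the
ranges and kernels of the idempotents `GF` and `FG`.
-/

open Filter Topology

noncomputable section

namespace StandardHilbertModule

theorem exists_preimage_norm_le_of_isClosed_range {𝕜 E F : Type*} [NontriviallyNormedField 𝕜]
    [NormedAddCommGroup E] [NormedSpace 𝕜 E] [CompleteSpace E] [NormedAddCommGroup F]
    [NormedSpace 𝕜 F] [CompleteSpace F] (T : E →L[𝕜] F) (hT : IsClosed (Set.range T)) :
    ∃ C > 0, ∀ y ∈ Set.range T, ∃ x, T x = y ∧ ‖x‖ ≤ C * ‖y‖ := by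
  have hrange : IsClosed (T.range : Set F) := by rwa [LinearMap.coe_range]
  have := hrange.completeSpace_coe
  let T' : E →L[𝕜] T.range := T.codRestrict T.range fun x => ⟨x, rfl⟩
  obtain ⟨C, hC, h⟩ := T'.exists_preimage_norm_le T.toLinearMap.surjective_rangeRestrict
  refine ⟨C, hC, fun y hy => ?_⟩
  obtain ⟨x, hx, hxn⟩ := h ⟨y, hy⟩
  exact ⟨x, congr(Subtype.val $hx), hxn⟩

theorem isTopCompl_of_isClosed_of_isScalarTower (𝕜 : Type*) {R E : Type*}
    [NontriviallyNormedField 𝕜] [Ring R] [NormedAddCommGroup E] [NormedSpace 𝕜 E] [CompleteSpace E]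
    [SMul 𝕜 R] [Module R E] [IsScalarTower 𝕜 R E] {M N : Submodule R E} (h : IsCompl M N)
    (hM : IsClosed (M : Set E)) (hN : IsClosed (N : Set E)) : M.IsTopCompl N := by
  have h𝕜 := Submodule.IsCompl.isTopCompl_of_isClosed
    ((Submodule.isCompl_restrictScalars_iff 𝕜).2 h) hM hN
  exact ⟨h, h𝕜.continuous_projection⟩

theorem isUnit_of_isSelfAdjoint_of_le_norm_mul {B : Type*} [CStarAlgebra B] {a : B}
    (ha : IsSelfAdjoint a) {c : ℝ} (hc : 0 < c) (h : ∀ b, c * ‖b‖ ≤ ‖a * b‖) : IsUnit a := by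
  rw [← spectrum.zero_notMem_iff ℝ]
  intro h0
  -- A bump function at `0`: `‖g a‖ ≥ |g 0| = 1`, while `‖a * g a‖ ≤ sup |t * g t| ≤ c / 2`.
  let g : ℝ → ℝ := fun t => max 0 (1 - |t| / (c / 2))
  have hg : Continuous g := by fun_prop
  have hnorm : 1 ≤ ‖cfc g a‖ := by
    simpa [g] using norm_apply_le_norm_cfc g a h0 hg.continuousOn ha
  have hmul : a * cfc g a = cfc (fun t => t * g t) a := by
    rw [cfc_mul (fun t => t) g a continuousOn_id hg.continuousOn, cfc_id' ℝ a]
  have hsmall : ‖a * cfc g a‖ ≤ c / 2 := by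
    rw [hmul]
    refine norm_cfc_le (by positivity) fun t _ => ?_
    rw [Real.norm_eq_abs, abs_mul]
    rcases le_total |t| (c / 2) with ht | ht
    · have h1 : |g t| ≤ 1 := by
        rw [abs_of_nonneg (le_max_left _ _)]
        exact max_le zero_le_one (sub_le_self _ (by positivity))
      nlinarith [abs_nonneg t, abs_nonneg (g t)]
    · have h1 : g t = 0 := max_eq_left (sub_nonpos.2 ((one_le_div (by positivity)).2 ht))
      rw [h1, abs_zero, mul_zero]
      positivity
  nlinarith [h (cfc g a)]

theorem isIdempotentElem_mul_left_of_outerInverse {M : Type*} [Semigroup M] {a g : M}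
    (h : g * a * g = g) : IsIdempotentElem (g * a) := by
  rw [IsIdempotentElem, ← mul_assoc, h]

theorem isIdempotentElem_mul_right_of_outerInverse {M : Type*} [Semigroup M] {a g : M}
    (h : g * a * g = g) : IsIdempotentElem (a * g) := by
  rw [IsIdempotentElem, mul_assoc, ← mul_assoc g, h]

theorem exists_outerInverse_of_isUnit {R : Type*} [Ring R] {a l p : R} (hp : IsIdempotentElem p)
    (hu : IsUnit (l * a + (1 - l * a) * p)) : ∃ g k, g * a * g = g ∧ 1 - g * a = k * p := by
  obtain ⟨u, hu⟩ := hu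
  have hinv : ↑u⁻¹ * (l * a) = 1 - ↑u⁻¹ * (1 - l * a) * p := by
    rw [eq_sub_iff_add_eq, mul_assoc, ← mul_add, ← hu, Units.inv_mul]
  have hcancel : ↑u⁻¹ * (l * a) * (1 - p) = 1 - p := by
    rw [hinv, sub_mul, one_mul, mul_assoc, hp.mul_one_sub_self, mul_zero, sub_zero]
  refine ⟨(1 - p) * ↑u⁻¹ * l, 1 + (1 - p) * ↑u⁻¹ * (1 - l * a), ?_, ?_⟩
  · calc (1 - p) * ↑u⁻¹ * l * a * ((1 - p) * ↑u⁻¹ * l)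
        = (1 - p) * (↑u⁻¹ * (l * a) * (1 - p)) * ↑u⁻¹ * l := by simp only [mul_assoc]
      _ = (1 - p) * ↑u⁻¹ * l := by rw [hcancel, hp.one_sub.eq]
  · calc 1 - (1 - p) * ↑u⁻¹ * l * a = 1 - (1 - p) * (↑u⁻¹ * (l * a)) := by
          simp only [mul_assoc]
      _ = (1 + (1 - p) * ↑u⁻¹ * (1 - l * a)) * p := by rw [hinv]; noncomm_ring

section Semigroups

theorem IsTwoSidedIdealIn.isMulSemigroup_ideal {S : Type*} [Mul S] {I T : Set S}
    (h : IsTwoSidedIdealIn I T) : IsMulSemigroup I :=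
  fun a ha b hb => h.mul_mem_left a (h.subset ha) b hb

theorem IsTwoSidedIdealIn.preimage {S S' F : Type*} [Mul S] [Mul S'] [FunLike F S S']
    [MulHomClass F S S'] {I T : Set S'} (h : IsTwoSidedIdealIn I T) (f : F) :
    IsTwoSidedIdealIn (f ⁻¹' I) (f ⁻¹' T) where
  isMulSemigroup a ha b hb := by
    simpa only [Set.mem_preimage, map_mul] using h.isMulSemigroup (f a) ha (f b) hb
  subset := Set.preimage_mono h.subset
  mul_mem_left a ha b hb := by
    simpa only [Set.mem_preimage, map_mul] using h.mul_mem_left (f a) ha (f b) hb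
  mul_mem_right a ha b hb := by
    simpa only [Set.mem_preimage, map_mul] using h.mul_mem_right (f a) ha (f b) hb

variable {M : Type*} [Monoid M]

theorem isUnit_and_isUnit_of_mul_left {l a b : M} (hl : l * a = 1) (hab : IsUnit (a * b)) :
    IsUnit a ∧ IsUnit b := by
  obtain ⟨c, hc⟩ := hab.exists_right_inv
  obtain ⟨u, rfl⟩ : IsUnit a :=
    isUnit_iff_exists_and_exists.2 ⟨⟨b * c, by rw [← mul_assoc, hc]⟩, ⟨l, hl⟩⟩
  exact ⟨u.isUnit, (Units.isUnit_units_mul u b).1 hab⟩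

theorem isUnit_and_isUnit_of_mul_right {a b r : M} (hr : b * r = 1) (hab : IsUnit (a * b)) :
    IsUnit a ∧ IsUnit b := by
  obtain ⟨c, hc⟩ := hab.exists_left_inv
  obtain ⟨u, rfl⟩ : IsUnit b :=
    isUnit_iff_exists_and_exists.2 ⟨⟨r, hr⟩, ⟨c * a, by rw [mul_assoc, hc]⟩⟩
  exact ⟨(Units.isUnit_mul_units a u).1 hab, u.isUnit⟩

variable (M)

theorem isTwoSidedIdealIn_leftInvertible_sdiff_isUnit :
    IsTwoSidedIdealIn ({a : M | ∃ l, l * a = 1} \ {a | IsUnit a}) {a | ∃ l, l * a = 1} := by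
  have hmul : IsMulSemigroup {a : M | ∃ l, l * a = 1} := by
    rintro a ⟨l, hl⟩ b ⟨m, hm⟩
    exact ⟨m * l, by rw [mul_assoc, ← mul_assoc l, hl, one_mul, hm]⟩
  have hunit (a : M) (ha : ∃ l, l * a = 1) (b : M) (hab : IsUnit (a * b)) : IsUnit a ∧ IsUnit b :=
    ha.elim fun _ hl => isUnit_and_isUnit_of_mul_left hl hab
  exact
    { isMulSemigroup := hmul
      subset := Set.sdiff_subset
      mul_mem_left := fun a ha b hb => ⟨hmul a ha b hb.1, fun hab => hb.2 (hunit a ha b hab).2⟩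
      mul_mem_right := fun a ha b hb => ⟨hmul a ha.1 b hb, fun hab => ha.2 (hunit a ha.1 b hab).1⟩ }

theorem isTwoSidedIdealIn_rightInvertible_sdiff_isUnit :
    IsTwoSidedIdealIn ({a : M | ∃ r, a * r = 1} \ {a | IsUnit a}) {a | ∃ r, a * r = 1} := by
  have hmul : IsMulSemigroup {a : M | ∃ r, a * r = 1} := by
    rintro a ⟨r, hr⟩ b ⟨s, hs⟩
    exact ⟨s * r, by rw [mul_assoc, ← mul_assoc b, hs, one_mul, hr]⟩
  have hunit (a b : M) (hb : ∃ r, b * r = 1) (hab : IsUnit (a * b)) : IsUnit a ∧ IsUnit b :=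
    hb.elim fun _ hr => isUnit_and_isUnit_of_mul_right hr hab
  exact
    { isMulSemigroup := hmul
      subset := Set.sdiff_subset
      mul_mem_left := fun a ha b hb => ⟨hmul a ha b hb.1, fun hab => hb.2 (hunit a b hb.1 hab).2⟩
      mul_mem_right := fun a ha b hb => ⟨hmul a ha.1 b hb, fun hab => ha.2 (hunit a b hb hab).1⟩ }

end Semigroups

variable {A : Type*} [CStarAlgebra A] [PartialOrder A] [StarOrderedRing A]

/-! ### The Banach space `ℓ²(A)` -/

namespace HA

@[simp] theorem sub_apply (x y : HA A) (i : ℕ) : (x - y) i = x i - y i := rfl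

/-- The truncation of a sequence to a finite set of indices, as an element of `H_A`. -/
def restrict (s : Finset ℕ) : (ℕ → A) →ₗ[A] HA A where
  toFun f := ⟨(s : Set ℕ).indicator f,
    summable_of_ne_finset_zero (s := s) fun i hi => by simp [hi]⟩
  map_add' f g := Subtype.ext (Set.indicator_add _ f g)
  map_smul' a f := Subtype.ext (Set.indicator_const_smul _ a f)

theorem restrict_apply (s : Finset ℕ) (f : ℕ → A) (i : ℕ) :
    restrict s f i = if i ∈ s then f i else 0 := by
  change (s : Set ℕ).indicator f i = _
  simp [Set.indicator_apply]

theorem inner_restrict_left (s : Finset ℕ) (f : ℕ → A) (x : HA A) :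
    inner A (restrict s f) x = ∑ i ∈ s, x i * star (f i) := by
  rw [inner_def, tsum_eq_sum (s := s) fun i hi => by simp [restrict_apply, hi]]
  exact Finset.sum_congr rfl fun i hi => by simp [restrict_apply, hi]

theorem norm_restrict_sq (s : Finset ℕ) (f : ℕ → A) :
    ‖restrict s f‖ ^ 2 = ‖∑ i ∈ s, f i * star (f i)‖ := by
  rw [CStarModule.norm_sq_eq A, inner_restrict_left]
  congr 1
  exact Finset.sum_congr rfl fun i hi => by simp [restrict_apply, hi]

theorem continuous_norm_restrict (s : Finset ℕ) :
    Continuous fun f : ℕ → A => ‖restrict s f‖ := by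
  have h (f : ℕ → A) : ‖restrict s f‖ = √‖∑ i ∈ s, f i * star (f i)‖ := by
    rw [← norm_restrict_sq, Real.sqrt_sq (norm_nonneg _)]
  simp only [h]
  fun_prop

theorem norm_restrict_le (s : Finset ℕ) (x : HA A) : ‖restrict s x‖ ≤ ‖x‖ := by
  rw [← sq_le_sq₀ (norm_nonneg _) (norm_nonneg _), norm_restrict_sq, CStarModule.norm_sq_eq A]
  exact CStarAlgebra.norm_le_norm_of_nonneg_of_le
    (Finset.sum_nonneg fun i _ => mul_star_self_nonneg _)
    (x.summable_self.sum_le_tsum s fun i _ => mul_star_self_nonneg _)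

theorem tendsto_norm_restrict (x : HA A) :
    Tendsto (fun s => ‖restrict s x‖) atTop (𝓝 ‖x‖) := by
  have h := (hasSum_inner x x).norm.sqrt
  rw [← CStarModule.norm_eq_sqrt_norm_inner_self] at h
  refine h.congr fun s => ?_
  rw [← norm_restrict_sq, Real.sqrt_sq (norm_nonneg _)]

theorem norm_le_of_forall_norm_restrict_le {x : HA A} {c : ℝ} (h : ∀ s, ‖restrict s x‖ ≤ c) :
    ‖x‖ ≤ c :=
  le_of_tendsto' (tendsto_norm_restrict x) h

theorem norm_apply_le (x : HA A) (i : ℕ) : ‖x i‖ ≤ ‖x‖ := by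
  refine le_trans ?_ (norm_restrict_le {i} x)
  rw [← sq_le_sq₀ (norm_nonneg _) (norm_nonneg _), norm_restrict_sq, Finset.sum_singleton,
    CStarRing.norm_self_mul_star, sq]

theorem mem_l2Submodule_iff {f : ℕ → A} : f ∈ l2Submodule A ↔
    ∀ ε > 0, ∃ s : Finset ℕ, ∀ t, Disjoint t s → ‖restrict t f‖ < ε := by
  refine summable_iff_vanishing_norm.trans ⟨fun h ε hε => ?_, fun h ε hε => ?_⟩
  · obtain ⟨s, hs⟩ := h (ε ^ 2) (by positivity)
    refine ⟨s, fun t ht => lt_of_pow_lt_pow_left₀ 2 hε.le ?_⟩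
    exact (norm_restrict_sq t f).trans_lt (hs t ht)
  · obtain ⟨s, hs⟩ := h (√ε) (by positivity)
    refine ⟨s, fun t ht => ?_⟩
    rw [← norm_restrict_sq, ← Real.sq_sqrt hε.le]
    gcongr
    exact hs t ht

theorem tendsto_restrict (x : HA A) : Tendsto (fun s => restrict s x) atTop (𝓝 x) := by
  refine Metric.tendsto_atTop.2 fun ε hε => ?_
  obtain ⟨s, hs⟩ := mem_l2Submodule_iff.1 x.2 (ε / 2) (half_pos hε)
  refine ⟨s, fun t hst => ?_⟩
  rw [dist_comm, dist_eq_norm]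
  refine (norm_le_of_forall_norm_restrict_le fun r => ?_).trans_lt (half_lt_self hε)
  have h : restrict r (x - restrict t x : HA A) = restrict (r \ t) x := by
    ext i
    by_cases hr : i ∈ r <;> by_cases ht : i ∈ t <;> simp [restrict_apply, hr, ht]
  rw [h]
  exact (hs _ (Finset.sdiff_disjoint.mono_right hst)).le

theorem norm_restrict_sub_le_of_tendsto {u : ℕ → HA A} {v : ℕ → A}
    (hv : Tendsto (fun k => (u k : ℕ → A)) atTop (𝓝 v)) {x : HA A} {c : ℝ}
    (hc : ∀ᶠ k in atTop, ‖x - u k‖ ≤ c) (s : Finset ℕ) : ‖restrict s ((x : ℕ → A) - v)‖ ≤ c :=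
  le_of_tendsto (((continuous_norm_restrict s).tendsto _).comp (hv.const_sub (x : ℕ → A)))
    (hc.mono fun k hk => (norm_restrict_le s (x - u k)).trans hk)

theorem exists_tendsto_coe {u : ℕ → HA A} (hu : CauchySeq u) :
    ∃ v : ℕ → A, Tendsto (fun k => (u k : ℕ → A)) atTop (𝓝 v) := by
  have h (i : ℕ) : ∃ a : A, Tendsto (fun k => u k i) atTop (𝓝 a) := by
    refine cauchySeq_tendsto_of_complete (Metric.cauchySeq_iff.2 fun ε hε => ?_)
    obtain ⟨N, hN⟩ := Metric.cauchySeq_iff.1 hu ε hε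
    refine ⟨N, fun m hm n hn => lt_of_le_of_lt ?_ (hN m hm n hn)⟩
    rw [dist_eq_norm, dist_eq_norm]
    exact norm_apply_le (u m - u n) i
  choose v hv using h
  exact ⟨v, tendsto_pi_nhds.2 hv⟩

instance : CompleteSpace (HA A) := by
  refine Metric.complete_of_cauchySeq_tendsto fun u hu => ?_
  obtain ⟨v, hv⟩ := exists_tendsto_coe hu
  have happrox (ε : ℝ) (hε : 0 < ε) :
      ∃ N, ∀ k ≥ N, ∀ s, ‖restrict s ((u k : ℕ → A) - v)‖ ≤ ε := by
    obtain ⟨N, hN⟩ := Metric.cauchySeq_iff.1 hu ε hε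
    refine ⟨N, fun k hk => norm_restrict_sub_le_of_tendsto hv ?_⟩
    filter_upwards [eventually_ge_atTop N] with l hl
    simpa only [dist_eq_norm] using (hN k hk l hl).le
  obtain ⟨w, rfl⟩ : ∃ w : HA A, (w : ℕ → A) = v := by
    refine ⟨⟨v, mem_l2Submodule_iff.2 fun ε hε => ?_⟩, rfl⟩
    obtain ⟨N, hN⟩ := happrox (ε / 2) (half_pos hε)
    obtain ⟨s, hs⟩ := mem_l2Submodule_iff.1 (u N).2 (ε / 2) (half_pos hε)
    refine ⟨s, fun t ht => ?_⟩
    calc ‖restrict t v‖ = ‖restrict t (u N) - restrict t ((u N : ℕ → A) - v)‖ := by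
          rw [← map_sub, sub_sub_cancel]
      _ ≤ ‖restrict t (u N)‖ + ‖restrict t ((u N : ℕ → A) - v)‖ := norm_sub_le _ _
      _ < ε := by linarith [hs t ht, hN N le_rfl t]
  refine ⟨w, Metric.tendsto_atTop.2 fun ε hε => ?_⟩
  obtain ⟨N, hN⟩ := happrox (ε / 2) (half_pos hε)
  refine ⟨N, fun k hk => ?_⟩
  rw [dist_eq_norm]
  exact (norm_le_of_forall_norm_restrict_le fun s => hN k hk s).trans_lt (half_lt_self hε)

theorem norm_smul_le (a : A) (x : HA A) : ‖a • x‖ ≤ ‖a‖ * ‖x‖ := by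
  rw [← sq_le_sq₀ (norm_nonneg _) (by positivity), CStarModule.norm_sq_eq A, mul_pow,
    CStarModule.norm_sq_eq A (x := x)]
  calc ‖(inner A (a • x) (a • x) : A)‖ = ‖a * inner A x x * star a‖ := by simp [mul_assoc]
    _ ≤ ‖a‖ * ‖(inner A x x : A)‖ * ‖star a‖ := norm_mul₃_le ..
    _ = ‖a‖ ^ 2 * ‖(inner A x x : A)‖ := by rw [norm_star]; ring

theorem ext_inner_right {x y : HA A} (h : ∀ z : HA A, (inner A x z : A) = inner A y z) :
    x = y := by
  rw [← sub_eq_zero, ← CStarModule.inner_self (A := A), CStarModule.inner_sub_left, h, sub_self]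

/-- The sequence with entry `1` at `i` and `0` elsewhere. -/
def basis (i : ℕ) : HA A := restrict {i} 1

theorem basis_apply (i j : ℕ) : (basis i : HA A) j = if j = i then 1 else 0 := by
  simp [basis, restrict_apply]

@[simp] theorem inner_basis_left (i : ℕ) (x : HA A) : (inner A (basis i) x : A) = x i := by
  simp [basis, inner_restrict_left]

theorem restrict_eq_sum (s : Finset ℕ) (f : ℕ → A) : restrict s f = ∑ i ∈ s, f i • basis i := by
  refine ext_inner_right fun x => ?_
  simp [inner_restrict_left, CStarModule.inner_sum_left, CStarModule.inner_op_smul_left]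

end HA

/-! ### The C⋆-algebra of adjointable operators -/

/-- `⟪T x, y⟫ = ⟪x, S y⟫` for all `x` and `y`, for maps `T` and `S` not assumed to be linear or
continuous. -/
def IsAdjointPair (T S : HA A → HA A) : Prop :=
  ∀ x y, (inner A (T x) y : A) = inner A x (S y)

theorem IsAdjointPair.symm {T S : HA A → HA A} (h : IsAdjointPair T S) : IsAdjointPair S T :=
  fun x y => by rw [← CStarModule.star_inner, ← h, CStarModule.star_inner]

/-- A map with an adjoint is automatically `A`-linear, because the inner product is nondegenerate,
and bounded, by the closed graph theorem. -/
def IsAdjointPair.toContinuousLinearMap {T S : HA A → HA A} (h : IsAdjointPair T S) :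
    HA A →L[A] HA A :=
  let f : HA A →ₗ[A] HA A :=
    { toFun := T
      map_add' := fun x x' => HA.ext_inner_right fun y => by
        simp only [h _ _, CStarModule.inner_add_left]
      map_smul' := fun a x => HA.ext_inner_right fun y => by
        simp only [h _ _, CStarModule.inner_op_smul_left, RingHom.id_apply] }
  { f with
    cont := (f.restrictScalars ℂ).continuous_of_seq_closed_graph fun u x y hu hy =>
      HA.ext_inner_right fun z => by
        have hinner (v : HA A) : Continuous fun w : HA A => (inner A w v : A) :=
          CStarModule.continuous_inner.comp (Continuous.prodMk_left v)
        have hTS (w : HA A) : (inner A (f w) z : A) = inner A w (S z) := h w z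
        refine tendsto_nhds_unique (((hinner z).tendsto y).comp hy) ?_
        simpa only [Function.comp_def, LinearMap.coe_restrictScalars, hTS]
          using ((hinner (S z)).tendsto x).comp hu }

namespace Ba

/-- The adjointable operator with underlying map `T`, where `S` is an adjoint of `T`. -/
def ofAdjointPair {T S : HA A → HA A} (h : IsAdjointPair T S) : Ba A :=
  ⟨h.toContinuousLinearMap, h.symm.toContinuousLinearMap, h⟩

instance : FunLike (Ba A) (HA A) (HA A) where
  coe F := (F : HA A →L[A] HA A)
  coe_injective _ _ h := Subtype.ext (DFunLike.coe_injective h)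

instance : ContinuousLinearMapClass (Ba A) A (HA A) (HA A) where
  map_add F := map_add (F : HA A →L[A] HA A)
  map_smulₛₗ F := map_smulₛₗ (F : HA A →L[A] HA A)
  map_continuous F := (F : HA A →L[A] HA A).continuous

@[ext] theorem ext {F G : Ba A} (h : ∀ x, F x = G x) : F = G := DFunLike.ext F G h

@[simp] theorem coe_apply (F : Ba A) (x : HA A) : (F : HA A →L[A] HA A) x = F x := rfl

instance : IsZeroApply (Ba A) (HA A) (HA A) := ⟨fun _ => rfl⟩

instance : IsOneApplyEqSelf (Ba A) (HA A) := ⟨fun _ => rfl⟩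

instance : IsAddApply (Ba A) (HA A) (HA A) := ⟨fun _ _ _ => rfl⟩

instance : IsSubApply (Ba A) (HA A) (HA A) := ⟨fun _ _ _ => rfl⟩

instance : IsMulApplyEqComp (Ba A) (HA A) := ⟨fun _ _ _ => rfl⟩

instance : Star (Ba A) where
  star F := ⟨F.2.choose, F, IsAdjointPair.symm F.2.choose_spec⟩

theorem inner_star_right (F : Ba A) (x y : HA A) :
    (inner A x (star F y) : A) = inner A (F x) y :=
  (F.2.choose_spec x y).symm

theorem inner_star_left (F : Ba A) (x y : HA A) :
    (inner A (star F x) y : A) = inner A x (F y) :=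
  IsAdjointPair.symm (fun x y => (inner_star_right F x y).symm) x y

theorem star_eq_of_inner {F G : Ba A} (h : IsAdjointPair F G) : star F = G :=
  ext fun x => HA.ext_inner_right fun y => by
    rw [inner_star_left, h.symm]

theorem star_ofAdjointPair {T S : HA A → HA A} (h : IsAdjointPair T S) :
    star (ofAdjointPair h) = ofAdjointPair h.symm :=
  star_eq_of_inner h

instance : StarRing (Ba A) where
  star_involutive F := star_eq_of_inner (inner_star_left F)
  star_mul F G := star_eq_of_inner fun x y => by simp [inner_star_right]
  star_add F G := star_eq_of_inner fun x y => by simp [inner_star_right]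

instance : Algebra ℂ (Ba A) :=
  RingHom.toAlgebra'
    { toFun := fun c => ofAdjointPair (T := fun x => c • x) (S := fun x => star c • x) fun x y => by
        rw [CStarModule.inner_smul_left_complex, CStarModule.inner_smul_right_complex]
      map_one' := ext fun x => one_smul ℂ x
      map_mul' := fun c d => ext fun x => mul_smul c d x
      map_zero' := ext fun x => zero_smul ℂ x
      map_add' := fun c d => ext fun x => add_smul c d x }
    fun c F => ext fun x => (((F : HA A →L[A] HA A).restrictScalars ℂ).map_smul c x).symm

instance : IsSMulApply ℂ (Ba A) (HA A) (HA A) := ⟨fun _ _ _ => rfl⟩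

/-- The inclusion of `Bᵃ(H_A)` into the bounded operators on the Banach space `H_A`; it induces the
operator norm on `Bᵃ(H_A)`. -/
def toBoundedOperators : Ba A →+* (HA A →L[ℂ] HA A) where
  toFun F := (F : HA A →L[A] HA A).restrictScalars ℂ
  map_one' := rfl
  map_mul' _ _ := rfl
  map_zero' := rfl
  map_add' _ _ := rfl

@[simp] theorem toBoundedOperators_apply (F : Ba A) (x : HA A) :
    toBoundedOperators F x = F x := rfl

theorem toBoundedOperators_injective : Function.Injective (toBoundedOperators (A := A)) :=
  fun _ _ h => ext fun x => congr($h x)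

instance : NormedRing (Ba A) :=
  NormedRing.induced _ _ toBoundedOperators toBoundedOperators_injective

theorem isometry_toBoundedOperators : Isometry (toBoundedOperators (A := A)) :=
  AddMonoidHomClass.isometry_of_norm _ fun _ => rfl

theorem le_opNorm (F : Ba A) (x : HA A) : ‖F x‖ ≤ ‖F‖ * ‖x‖ :=
  (toBoundedOperators F).le_opNorm x

theorem opNorm_le_bound (F : Ba A) {c : ℝ} (hc : 0 ≤ c) (h : ∀ x, ‖F x‖ ≤ c * ‖x‖) : ‖F‖ ≤ c :=
  (toBoundedOperators F).opNorm_le_bound hc h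

instance : NormedAlgebra ℂ (Ba A) where
  norm_smul_le c F := norm_smul_le c (toBoundedOperators F)

instance : CStarRing (Ba A) where
  norm_mul_self_le F := by
    have h : ‖F‖ ≤ √‖star F * F‖ := by
      refine opNorm_le_bound F (Real.sqrt_nonneg _) fun x => ?_
      rw [← sq_le_sq₀ (norm_nonneg _) (by positivity), mul_pow, Real.sq_sqrt (norm_nonneg _)]
      calc ‖F x‖ ^ 2 = ‖(inner A x ((star F * F) x) : A)‖ := by
            rw [CStarModule.norm_sq_eq A, mul_apply_eq_comp, inner_star_right]
        _ ≤ ‖x‖ * ‖(star F * F) x‖ := CStarModule.norm_inner_le (HA A)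
        _ ≤ ‖x‖ * (‖star F * F‖ * ‖x‖) := by gcongr; exact le_opNorm _ x
        _ = ‖star F * F‖ * ‖x‖ ^ 2 := by ring
    simpa using mul_self_le_mul_self (norm_nonneg F) h

instance : StarModule ℂ (Ba A) where
  star_smul c F := star_eq_of_inner fun x y => by
    simp [inner_star_right]

instance : CompleteSpace (Ba A) := by
  refine Metric.complete_of_cauchySeq_tendsto fun u hu => ?_
  have hlim (v : ℕ → Ba A) (hv : CauchySeq v) :
      ∃ T, Tendsto (fun n => toBoundedOperators (v n)) atTop (𝓝 T) :=
    cauchySeq_tendsto_of_complete (hv.map isometry_toBoundedOperators.uniformContinuous)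
  have hstar : CauchySeq fun n => star (u n) := hu.map (starₗᵢ ℂ).isometry.uniformContinuous
  obtain ⟨T, hT⟩ := hlim u hu
  obtain ⟨S, hS⟩ := hlim _ hstar
  have hTS : IsAdjointPair T S := fun x y => by
    have hinner := CStarModule.continuous_inner (A := A) (E := HA A)
    refine tendsto_nhds_unique
      ((hinner.tendsto (T x, y)).comp ((hT.eval_const x).prodMk_nhds tendsto_const_nhds)) ?_
    refine ((hinner.tendsto (x, S y)).comp
      (tendsto_const_nhds.prodMk_nhds (hS.eval_const y))).congr fun n => ?_
    exact inner_star_right (u n) x y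
  exact ⟨ofAdjointPair hTS, isometry_toBoundedOperators.isEmbedding.tendsto_nhds_iff.2 hT⟩

instance : CStarAlgebra (Ba A) where

theorem isUnit_of_isSelfAdjoint_of_le_norm {T : Ba A} (hT : IsSelfAdjoint T) {c : ℝ} (hc : 0 < c)
    (h : ∀ x, c * ‖x‖ ≤ ‖T x‖) : IsUnit T := by
  refine isUnit_of_isSelfAdjoint_of_le_norm_mul hT hc fun S => ?_
  rw [← le_div_iff₀' hc]
  refine opNorm_le_bound S (by positivity) fun x => ?_
  rw [div_mul_eq_mul_div, le_div_iff₀' hc]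
  exact (h (S x)).trans (le_opNorm (T * S) x)

theorem inner_star_mul_self_apply (T : Ba A) (x : HA A) :
    (inner A x ((star T * T) x) : A) = inner A (T x) (T x) :=
  inner_star_right T x (T x)

theorem isUnit_star_mul_self_add_star_mul_self {T₁ T₂ : Ba A} {c : ℝ} (hc : 0 < c)
    (h : ∀ x, ‖x‖ ≤ c * (‖T₁ x‖ + ‖T₂ x‖)) : IsUnit (star T₁ * T₁ + star T₂ * T₂) := by
  set Q := star T₁ * T₁ + star T₂ * T₂
  have hQ : IsSelfAdjoint Q := (IsSelfAdjoint.star_mul_self _).add (.star_mul_self _)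
  have hinner (x : HA A) :
      (inner A x (Q x) : A) = inner A (T₁ x) (T₁ x) + inner A (T₂ x) (T₂ x) := by
    simp only [Q, add_apply, CStarModule.inner_add_right, inner_star_mul_self_apply]
  have hdom (x y : HA A) (hy : (inner A y y : A) ≤ inner A x (Q x)) : ‖y‖ ^ 2 ≤ ‖x‖ * ‖Q x‖ := by
    rw [CStarModule.norm_sq_eq A]
    exact (CStarAlgebra.norm_le_norm_of_nonneg_of_le CStarModule.inner_self_nonneg hy).trans
      (CStarModule.norm_inner_le (HA A))
  have h₁ (x : HA A) : ‖T₁ x‖ ^ 2 ≤ ‖x‖ * ‖Q x‖ := by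
    refine hdom x _ ?_
    exact hinner x ▸ le_add_of_nonneg_right CStarModule.inner_self_nonneg
  have h₂ (x : HA A) : ‖T₂ x‖ ^ 2 ≤ ‖x‖ * ‖Q x‖ := by
    refine hdom x _ ?_
    exact hinner x ▸ le_add_of_nonneg_left CStarModule.inner_self_nonneg
  refine isUnit_of_isSelfAdjoint_of_le_norm hQ (c := (4 * c ^ 2)⁻¹) (by positivity) fun x => ?_
  rw [inv_mul_le_iff₀ (by positivity)]
  rcases (norm_nonneg x).eq_or_lt with hx | hx
  · rw [← hx]; positivity
  refine le_of_mul_le_mul_left ?_ hx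
  calc ‖x‖ * ‖x‖ ≤ (c * (‖T₁ x‖ + ‖T₂ x‖)) * (c * (‖T₁ x‖ + ‖T₂ x‖)) :=
        mul_self_le_mul_self hx.le (h x)
    _ ≤ c ^ 2 * (2 * (‖T₁ x‖ ^ 2 + ‖T₂ x‖ ^ 2)) := by
        nlinarith [mul_nonneg (sq_nonneg c) (sq_nonneg (‖T₁ x‖ - ‖T₂ x‖))]
    _ ≤ c ^ 2 * (2 * (‖x‖ * ‖Q x‖ + ‖x‖ * ‖Q x‖)) := by gcongr <;> simp only [h₁, h₂]
    _ = ‖x‖ * (4 * c ^ 2 * ‖Q x‖) := by ring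

theorem isUnit_star_mul_self_add_mul_star {T S : Ba A} (hS : IsClosed (Set.range S))
    (R : HA A →L[A] HA A) (hRS : ∀ x, R x ∈ Set.range S) {c : ℝ} (hc : 0 ≤ c)
    (hT : ∀ x, ‖(inner A x (x - R x) : A)‖ ≤ c * ‖T x‖ * ‖x‖) :
    IsUnit (star T * T + S * star S) := by
  obtain ⟨C, hC, hlift⟩ := exists_preimage_norm_le_of_isClosed_range (toBoundedOperators S) hS
  set r := ‖R.restrictScalars ℂ‖
  have hR (x : HA A) : ‖(inner A x (R x) : A)‖ ≤ C * r * ‖star S x‖ * ‖x‖ := by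
    obtain ⟨w, hw, hwn⟩ := hlift (R x) (hRS x)
    calc ‖(inner A x (R x) : A)‖ = ‖(inner A (star S x) w : A)‖ := by
          rw [inner_star_left, ← hw, toBoundedOperators_apply]
      _ ≤ ‖star S x‖ * ‖w‖ := CStarModule.norm_inner_le (HA A)
      _ ≤ ‖star S x‖ * (C * (r * ‖x‖)) := by
          gcongr
          exact hwn.trans (by gcongr; exact (R.restrictScalars ℂ).le_opNorm x)
      _ = C * r * ‖star S x‖ * ‖x‖ := by ring
  have h (x : HA A) : ‖x‖ ≤ (c + C * r + 1) * (‖T x‖ + ‖star S x‖) := by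
    rcases (norm_nonneg x).eq_or_lt with hx | hx
    · rw [← hx]; positivity
    refine le_of_mul_le_mul_right ?_ hx
    calc ‖x‖ * ‖x‖ = ‖(inner A x (x - R x) + inner A x (R x) : A)‖ := by
          rw [← CStarModule.inner_add_right, sub_add_cancel, ← sq, CStarModule.norm_sq_eq A]
      _ ≤ c * ‖T x‖ * ‖x‖ + C * r * ‖star S x‖ * ‖x‖ := norm_add_le_of_le (hT x) (hR x)
      _ = (c * ‖T x‖ + C * r * ‖star S x‖) * ‖x‖ := by ring
      _ ≤ ((c + C * r + 1) * ‖T x‖ + (c + C * r + 1) * ‖star S x‖) * ‖x‖ := by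
          have : 0 ≤ C * r := by positivity
          gcongr <;> linarith
      _ = (c + C * r + 1) * (‖T x‖ + ‖star S x‖) * ‖x‖ := by ring
  simpa using isUnit_star_mul_self_add_star_mul_self (T₁ := T) (T₂ := star S) (by positivity) h

/-! ### Operators of finite rank -/

/-- The rank one operator `z ↦ ⟪y, z⟫ x`, usually written `θ_{x,y}`. -/
def rankOne (x y : HA A) : Ba A :=
  ofAdjointPair (T := fun z => (inner A y z : A) • x) (S := fun z => (inner A x z : A) • y)
    fun z w => by
      rw [CStarModule.inner_op_smul_left, CStarModule.inner_op_smul_right, CStarModule.star_inner]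

@[simp] theorem rankOne_apply (x y z : HA A) : rankOne x y z = (inner A y z : A) • x := rfl

theorem star_rankOne (x y : HA A) : star (rankOne x y) = rankOne y x :=
  star_ofAdjointPair _

theorem mul_rankOne (F : Ba A) (x y : HA A) : F * rankOne x y = rankOne (F x) y := by
  ext z : 1
  simp

theorem rankOne_mul (x y : HA A) (F : Ba A) : rankOne x y * F = rankOne x (star F y) := by
  ext z : 1
  simp [inner_star_left]

theorem norm_rankOne_le (x y : HA A) : ‖rankOne x y‖ ≤ ‖x‖ * ‖y‖ := by
  refine opNorm_le_bound _ (by positivity) fun z => ?_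
  calc ‖(inner A y z : A) • x‖ ≤ ‖(inner A y z : A)‖ * ‖x‖ := HA.norm_smul_le _ _
    _ ≤ ‖y‖ * ‖z‖ * ‖x‖ := by gcongr; exact CStarModule.norm_inner_le (HA A)
    _ = ‖x‖ * ‖y‖ * ‖z‖ := by ring

variable (A) in
/-- The ideal of the operators of finite `A`-rank: the finite sums of rank one operators. -/
def finiteRank : Ideal (Ba A) :=
  Ideal.span (Set.range fun p : HA A × HA A => rankOne p.1 p.2)

theorem rankOne_mem_finiteRank (x y : HA A) : rankOne x y ∈ finiteRank A :=
  Ideal.subset_span ⟨(x, y), rfl⟩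

@[elab_as_elim]
theorem finiteRank_induction {p : Ba A → Prop} (rankOne : ∀ x y, p (rankOne x y))
    (zero : p 0) (add : ∀ F G, p F → p G → p (F + G)) {K : Ba A} (hK : K ∈ finiteRank A) : p K := by
  have h : ∀ F : Ba A, p (F * K) := by
    induction hK using Submodule.span_induction with
    | mem K hK =>
      obtain ⟨⟨x, y⟩, rfl⟩ := hK
      exact fun F => mul_rankOne F x y ▸ rankOne (F x) y
    | zero => simpa using zero
    | add K L _ _ hK hL => exact fun F => mul_add F K L ▸ add _ _ (hK F) (hL F)
    | smul G K _ hK => exact fun F => by simpa [mul_assoc] using hK (F * G)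
  simpa using h 1

instance : (finiteRank A).IsTwoSided where
  mul_mem_of_left {K} F hK := by
    refine finiteRank_induction (fun x y => ?_) ?_ (fun K L hK hL => ?_) hK
    · exact rankOne_mul x y F ▸ rankOne_mem_finiteRank x _
    · simp
    · exact add_mul K L F ▸ add_mem hK hL

theorem star_mem_finiteRank {K : Ba A} (hK : K ∈ finiteRank A) : star K ∈ finiteRank A := by
  refine finiteRank_induction (fun x y => ?_) ?_ (fun K L hK hL => ?_) hK
  · exact star_rankOne x y ▸ rankOne_mem_finiteRank y x
  · simp
  · exact star_add K L ▸ add_mem hK hL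

theorem exists_fg_forall_apply_mem {K : Ba A} (hK : K ∈ finiteRank A) :
    ∃ W : Submodule A (HA A), W.FG ∧ ∀ x, K x ∈ W := by
  refine finiteRank_induction (fun x y => ?_) ?_ (fun K L hK hL => ?_) hK
  · exact ⟨A ∙ x, Submodule.fg_span_singleton x, fun z =>
      Submodule.smul_mem _ _ (Submodule.mem_span_singleton_self x)⟩
  · exact ⟨⊥, Submodule.fg_bot, fun x => rfl⟩
  · obtain ⟨V, hV, hKV⟩ := hK
    obtain ⟨W, hW, hLW⟩ := hL
    exact ⟨V ⊔ W, hV.sup hW, fun x => Submodule.add_mem_sup (hKV x) (hLW x)⟩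

theorem ker_fg_of_one_sub_mem {E : Ba A} (hidem : IsIdempotentElem E)
    (hE : 1 - E ∈ finiteRank A) : (E : HA A →L[A] HA A).ker.FG := by
  obtain ⟨W, hW, hEW⟩ := exists_fg_forall_apply_mem hE
  have h : (E : HA A →L[A] HA A).ker = W.map ((1 - E : Ba A) : HA A →L[A] HA A).toLinearMap := by
    ext x
    constructor
    · intro hx
      have hx : (1 - E) x = x := by rw [sub_apply, one_apply_eq_self, sub_eq_self]; exact hx
      exact ⟨x, hx ▸ hEW x, hx⟩
    · rintro ⟨x, -, rfl⟩
      exact congr($(hidem.mul_one_sub_self) x)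
  exact h ▸ hW.map _

theorem exists_range_eq_of_fg {N : Submodule A (HA A)} (hN : N.FG) :
    ∃ S ∈ finiteRank A, (S : HA A →L[A] HA A).range = N := by
  obtain ⟨n, v, rfl⟩ := Submodule.fg_iff_exists_fin_generating_family.1 hN
  let S : Ba A := ∑ i, rankOne (v i) (HA.basis i)
  have hS (z : HA A) : S z = ∑ i : Fin n, z i • v i := by simp [S]
  have hbasis (j : Fin n) : S (HA.basis j) = v j := by
    simp [hS, HA.basis_apply, Fin.val_inj]
  refine ⟨S, sum_mem fun i _ => rankOne_mem_finiteRank _ _, le_antisymm ?_ ?_⟩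
  · rintro _ ⟨z, rfl⟩
    exact hS z ▸ sum_mem fun i _ => Submodule.smul_mem _ _ (Submodule.subset_span ⟨i, rfl⟩)
  · exact Submodule.span_le.2 (Set.range_subset_iff.2 fun j => ⟨HA.basis j, hbasis j⟩)

/-- The projection of `H_A` onto the sequences supported in a finite set of indices. -/
def coordProj (s : Finset ℕ) : Ba A := ∑ i ∈ s, rankOne (HA.basis i) (HA.basis i)

theorem coordProj_mem_finiteRank (s : Finset ℕ) : coordProj s ∈ finiteRank A :=
  sum_mem fun _ _ => rankOne_mem_finiteRank _ _

theorem coordProj_apply (s : Finset ℕ) (x : HA A) : coordProj s x = HA.restrict s x := by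
  simp [coordProj, HA.restrict_eq_sum]

theorem isSelfAdjoint_coordProj (s : Finset ℕ) : IsSelfAdjoint (coordProj s : Ba A) := by
  simp only [IsSelfAdjoint, coordProj, star_sum, star_rankOne]

theorem isIdempotentElem_coordProj (s : Finset ℕ) : IsIdempotentElem (coordProj s : Ba A) := by
  ext x i
  by_cases hi : i ∈ s <;> simp [coordProj_apply, HA.restrict_apply, hi]

theorem tendsto_mul_one_sub_coordProj {K : Ba A} (hK : K ∈ finiteRank A) :
    Tendsto (fun s => K * (1 - coordProj s)) atTop (𝓝 0) := by
  refine finiteRank_induction (fun x y => ?_) ?_ (fun K L hK hL => ?_) hK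
  · have h (s : Finset ℕ) : rankOne x y * (1 - coordProj s) = rankOne x (y - HA.restrict s y) := by
      rw [rankOne_mul, star_sub, star_one, isSelfAdjoint_coordProj, sub_apply,
        one_apply_eq_self, coordProj_apply]
    simp only [h]
    refine squeeze_zero_norm (fun s => norm_rankOne_le x _) ?_
    simpa using ((HA.tendsto_restrict y).const_sub y).norm.const_mul ‖x‖
  · simp
  · simpa only [add_mul, add_zero] using hK.add hL

theorem exists_outerInverse_of_leftInverse_mod_finiteRank {F L : Ba A}
    (h : 1 - L * F ∈ finiteRank A) :
    ∃ G, G * F * G = G ∧ 1 - G * F ∈ finiteRank A := by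
  obtain ⟨s, hs⟩ : ∃ s : Finset ℕ, ‖(1 - L * F) * (1 - coordProj s)‖ < 1 :=
    ((tendsto_mul_one_sub_coordProj h).norm.eventually_lt_const (by simp)).exists
  have hu : IsUnit (L * F + (1 - L * F) * coordProj s) := by
    convert isUnit_one_sub_of_norm_lt_one hs using 1
    noncomm_ring
  obtain ⟨G, K, hG, hK⟩ := exists_outerInverse_of_isUnit (isIdempotentElem_coordProj s) hu
  exact ⟨G, hG, hK ▸ Ideal.mul_mem_left _ K (coordProj_mem_finiteRank s)⟩

theorem exists_outerInverse_of_rightInverse_mod_finiteRank {F R : Ba A}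
    (h : 1 - F * R ∈ finiteRank A) :
    ∃ G, G * F * G = G ∧ 1 - F * G ∈ finiteRank A := by
  have hstar : 1 - star R * star F ∈ finiteRank A := by
    simpa using star_mem_finiteRank h
  obtain ⟨G, hG, hGF⟩ := exists_outerInverse_of_leftInverse_mod_finiteRank hstar
  refine ⟨star G, ?_, ?_⟩
  · simpa [mul_assoc] using congr(star $hG)
  · simpa using star_mem_finiteRank hGF

end Ba

/-! ### Decompositions and invertibility modulo finite rank -/

theorem IsDiagonalDecomposition.of_outerInverse {F G : HA A →L[A] HA A} (h : G * F * G = G) :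
    IsDiagonalDecomposition F (G * F).range (G * F).ker (F * G).range (F * G).ker := by
  have hG (y : HA A) : G (F (G y)) = G y := congr($h y)
  let F₁ : (G * F).range →L[A] (F * G).range :=
    F.restrict (by rintro _ ⟨x, rfl⟩; exact ⟨F x, rfl⟩)
  let G₁ : (F * G).range →L[A] (G * F).range :=
    G.restrict (by rintro _ ⟨y, rfl⟩; exact ⟨G y, rfl⟩)
  have hleft : Function.LeftInverse G₁ F₁ := by
    rintro ⟨_, x, rfl⟩
    exact Subtype.ext (hG (F x))
  have hright : Function.RightInverse G₁ F₁ := by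
    rintro ⟨_, y, rfl⟩
    exact Subtype.ext congr(F $(hG y))
  have hdomain : (G * F).range.IsTopCompl (G * F).ker :=
    ContinuousLinearMap.IsIdempotentElem.isTopCompl
      (isIdempotentElem_mul_left_of_outerInverse h)
  have hrange : (F * G).range.IsTopCompl (F * G).ker :=
    ContinuousLinearMap.IsIdempotentElem.isTopCompl
      (isIdempotentElem_mul_right_of_outerInverse h)
  exact
    { isClosed_M₁ := hdomain.isClosed
      isClosed_N₁ := hdomain.isClosed'
      isClosed_M₂ := hrange.isClosed
      isClosed_N₂ := hrange.isClosed'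
      isCompl_domain := hdomain.isCompl
      isCompl_range := hrange.isCompl
      exists_iso := ⟨.equivOfInverse F₁ G₁ hleft hright, fun _ => rfl⟩
      map_N₁ := fun x hx => (congr(F $hx) : F (G (F x)) = F 0).trans (map_zero F) }

theorem IsDiagonalDecomposition.exists_parametrix {F : HA A →L[A] HA A}
    {M₁ N₁ M₂ N₂ : Submodule A (HA A)} (h : IsDiagonalDecomposition F M₁ N₁ M₂ N₂) :
    ∃ G : HA A →L[A] HA A, (∀ x, x - G (F x) ∈ N₁) ∧ ∀ y, y - F (G y) ∈ N₂ := by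
  obtain ⟨F₁, hF₁⟩ := h.exists_iso
  have hrange : M₂.IsTopCompl N₂ :=
    isTopCompl_of_isClosed_of_isScalarTower ℂ h.isCompl_range h.isClosed_M₂ h.isClosed_N₂
  let P : HA A →L[A] M₂ := M₂.projectionOntoL N₂ hrange
  let G : HA A →L[A] HA A := M₁.subtypeL ∘L (F₁.symm : M₂ →L[A] M₁) ∘L P
  have hG (y : HA A) : G y = F₁.symm (P y) := rfl
  have hPF (m : M₁) : P (F m) = F₁ m := by
    rw [hF₁, Submodule.projectionOntoL_apply_left]
  have hPN {n : HA A} (hn : n ∈ N₂) : P n = 0 :=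
    Submodule.projectionOntoL_apply_eq_zero_of_mem_right hrange hn
  refine ⟨G, fun x => ?_, fun y => ?_⟩
  · obtain ⟨m, n, rfl, -⟩ := Submodule.existsUnique_add_of_isCompl h.isCompl_domain x
    have hGF : G (F (m + n)) = m := by
      rw [hG, map_add, map_add, hPF, hPN (h.map_N₁ n n.2), add_zero, F₁.symm_apply_apply]
    rw [hGF, add_sub_cancel_left]
    exact n.2
  · have hFG : F (G y) = P y := by rw [hG, hF₁, F₁.apply_symm_apply]
    rw [← Submodule.projectionOntoL_apply_eq_zero_iff hrange, map_sub, hFG,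
      Submodule.projectionOntoL_apply_left, sub_self]

theorem IsDiagonalDecomposition.exists_leftInverse_mod_finiteRank {F : Ba A}
    {M₁ N₁ M₂ N₂ : Submodule A (HA A)}
    (h : IsDiagonalDecomposition (F : HA A →L[A] HA A) M₁ N₁ M₂ N₂) (hN₁ : N₁.FG) :
    ∃ L, 1 - L * F ∈ Ba.finiteRank A := by
  obtain ⟨G, hG, -⟩ := h.exists_parametrix
  obtain ⟨S, hS, rfl⟩ := Ba.exists_range_eq_of_fg hN₁
  obtain ⟨u, hu⟩ : IsUnit (star F * F + S * star S) := by
    refine Ba.isUnit_star_mul_self_add_mul_star h.isClosed_N₁ (1 - G * F) hG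
      (norm_nonneg (G.restrictScalars ℂ)) fun x => ?_
    calc ‖(inner A x (x - (1 - G * F) x) : A)‖ = ‖(inner A x (G (F x)) : A)‖ := by
          simp
      _ ≤ ‖x‖ * ‖G (F x)‖ := CStarModule.norm_inner_le (HA A)
      _ ≤ ‖x‖ * (‖G.restrictScalars ℂ‖ * ‖F x‖) := by
          gcongr
          exact (G.restrictScalars ℂ).le_opNorm (F x)
      _ = ‖G.restrictScalars ℂ‖ * ‖F x‖ * ‖x‖ := by ring
  refine ⟨↑u⁻¹ * star F, ?_⟩
  have hone : 1 - ↑u⁻¹ * star F * F = ↑u⁻¹ * S * star S := by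
    rw [sub_eq_iff_eq_add', mul_assoc, mul_assoc, ← mul_add, ← hu, Units.inv_mul]
  rw [hone]
  exact Ideal.mul_mem_right _ _ (Ideal.mul_mem_left _ _ hS)

theorem IsDiagonalDecomposition.exists_rightInverse_mod_finiteRank {F : Ba A}
    {M₁ N₁ M₂ N₂ : Submodule A (HA A)}
    (h : IsDiagonalDecomposition (F : HA A →L[A] HA A) M₁ N₁ M₂ N₂) (hN₂ : N₂.FG) :
    ∃ R, 1 - F * R ∈ Ba.finiteRank A := by
  obtain ⟨G, -, hG⟩ := h.exists_parametrix
  obtain ⟨S, hS, rfl⟩ := Ba.exists_range_eq_of_fg hN₂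
  obtain ⟨u, hu⟩ : IsUnit (F * star F + S * star S) := by
    rw [← star_star F, star_star (star F)]
    refine Ba.isUnit_star_mul_self_add_mul_star h.isClosed_N₂ (1 - F * G) hG
      (norm_nonneg (G.restrictScalars ℂ)) fun y => ?_
    calc ‖(inner A y (y - (1 - (F : HA A →L[A] HA A) * G) y) : A)‖
          = ‖(inner A (star F y) (G y) : A)‖ := by
          rw [Ba.inner_star_left]; simp
      _ ≤ ‖star F y‖ * ‖G y‖ := CStarModule.norm_inner_le (HA A)
      _ ≤ ‖star F y‖ * (‖G.restrictScalars ℂ‖ * ‖y‖) := by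
          gcongr
          exact (G.restrictScalars ℂ).le_opNorm y
      _ = ‖G.restrictScalars ℂ‖ * ‖star F y‖ * ‖y‖ := by ring
  refine ⟨star F * ↑u⁻¹, ?_⟩
  have hone : 1 - F * (star F * ↑u⁻¹) = S * (star S * ↑u⁻¹) := by
    rw [sub_eq_iff_eq_add', ← mul_assoc, ← mul_assoc, ← add_mul, ← hu, Units.mul_inv]
  rw [hone]
  exact Ideal.mul_mem_right _ _ hS

variable (A) in
/-- The quotient map from `Bᵃ(H_A)` to its quotient by the operators of finite `A`-rank, an
algebraic version of the Calkin algebra: the ideal of operators of finite rank is not closed. -/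
abbrev modFiniteRank : Ba A →+* Ba A ⧸ Ba.finiteRank A := Ideal.Quotient.mk _

theorem modFiniteRank_mul_eq_one_iff {F G : Ba A} :
    modFiniteRank A F * modFiniteRank A G = 1 ↔ 1 - F * G ∈ Ba.finiteRank A := by
  rw [← map_mul, ← map_one (modFiniteRank A), eq_comm, Ideal.Quotient.eq]

theorem mPhiPlus_eq_preimage : MPhiPlus A = modFiniteRank A ⁻¹' {a | ∃ l, l * a = 1} := by
  ext F
  constructor
  · rintro ⟨_, _, _, _, h, hN₁⟩
    obtain ⟨L, hL⟩ := h.exists_leftInverse_mod_finiteRank hN₁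
    exact ⟨_, modFiniteRank_mul_eq_one_iff.2 hL⟩
  · rintro ⟨l, hl⟩
    obtain ⟨L, rfl⟩ := Ideal.Quotient.mk_surjective l
    obtain ⟨G, hG, hGF⟩ :=
      Ba.exists_outerInverse_of_leftInverse_mod_finiteRank (modFiniteRank_mul_eq_one_iff.1 hl)
    exact ⟨_, _, _, _, .of_outerInverse congr(Subtype.val $hG),
      Ba.ker_fg_of_one_sub_mem (isIdempotentElem_mul_left_of_outerInverse hG) hGF⟩

theorem mPhiMinus_eq_preimage : MPhiMinus A = modFiniteRank A ⁻¹' {a | ∃ r, a * r = 1} := by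
  ext F
  constructor
  · rintro ⟨_, _, _, _, h, hN₂⟩
    obtain ⟨R, hR⟩ := h.exists_rightInverse_mod_finiteRank hN₂
    exact ⟨_, modFiniteRank_mul_eq_one_iff.2 hR⟩
  · rintro ⟨r, hr⟩
    obtain ⟨R, rfl⟩ := Ideal.Quotient.mk_surjective r
    obtain ⟨G, hG, hFG⟩ :=
      Ba.exists_outerInverse_of_rightInverse_mod_finiteRank (modFiniteRank_mul_eq_one_iff.1 hr)
    exact ⟨_, _, _, _, .of_outerInverse congr(Subtype.val $hG),
      Ba.ker_fg_of_one_sub_mem (isIdempotentElem_mul_right_of_outerInverse hG) hFG⟩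

theorem mPhi_eq_preimage : MPhi A = modFiniteRank A ⁻¹' {a | IsUnit a} := by
  ext F
  constructor
  · rintro ⟨_, _, _, _, h, hN₁, hN₂⟩
    obtain ⟨L, hL⟩ := h.exists_leftInverse_mod_finiteRank hN₁
    obtain ⟨R, hR⟩ := h.exists_rightInverse_mod_finiteRank hN₂
    exact isUnit_iff_exists_and_exists.2
      ⟨⟨_, modFiniteRank_mul_eq_one_iff.2 hR⟩, ⟨_, modFiniteRank_mul_eq_one_iff.2 hL⟩⟩
  · intro (hF : IsUnit (modFiniteRank A F))
    obtain ⟨l, hl⟩ := hF.exists_left_inv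
    obtain ⟨r, hr⟩ := hF.exists_right_inv
    obtain ⟨L, rfl⟩ := Ideal.Quotient.mk_surjective l
    obtain ⟨G, hG, hGF⟩ :=
      Ba.exists_outerInverse_of_leftInverse_mod_finiteRank (modFiniteRank_mul_eq_one_iff.1 hl)
    have hGr : modFiniteRank A G = r :=
      left_inv_eq_right_inv (modFiniteRank_mul_eq_one_iff.2 hGF) hr
    have hFG : 1 - F * G ∈ Ba.finiteRank A := modFiniteRank_mul_eq_one_iff.1 (hGr ▸ hr)
    exact ⟨_, _, _, _, .of_outerInverse congr(Subtype.val $hG),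
      Ba.ker_fg_of_one_sub_mem (isIdempotentElem_mul_left_of_outerInverse hG) hGF,
      Ba.ker_fg_of_one_sub_mem (isIdempotentElem_mul_right_of_outerInverse hG) hFG⟩

variable (A)

theorem isTwoSidedIdealIn_mPhiPlus_sdiff_mPhi :
    IsTwoSidedIdealIn (MPhiPlus A \ MPhi A) (MPhiPlus A) := by
  rw [mPhiPlus_eq_preimage, mPhi_eq_preimage, ← Set.preimage_sdiff]
  exact (isTwoSidedIdealIn_leftInvertible_sdiff_isUnit _).preimage (modFiniteRank A)

theorem isTwoSidedIdealIn_mPhiMinus_sdiff_mPhi :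
    IsTwoSidedIdealIn (MPhiMinus A \ MPhi A) (MPhiMinus A) := by
  rw [mPhiMinus_eq_preimage, mPhi_eq_preimage, ← Set.preimage_sdiff]
  exact (isTwoSidedIdealIn_rightInvertible_sdiff_isUnit _).preimage (modFiniteRank A)

end StandardHilbertModule

end

theorem corollary2p10 (A : Type*) [CStarAlgebra A] [PartialOrder A] [StarOrderedRing A] :
    StandardHilbertModule.IsTwoSidedIdealIn
        (StandardHilbertModule.MPhiPlus A \ StandardHilbertModule.MPhi A)
        (StandardHilbertModule.MPhiPlus A) ∧
      StandardHilbertModule.IsTwoSidedIdealIn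
        (StandardHilbertModule.MPhiMinus A \ StandardHilbertModule.MPhi A)
        (StandardHilbertModule.MPhiMinus A) ∧
      StandardHilbertModule.IsMulSemigroup
        (StandardHilbertModule.MPhiPlus A \ StandardHilbertModule.MPhi A) ∧
      StandardHilbertModule.IsMulSemigroup
        (StandardHilbertModule.MPhiMinus A \ StandardHilbertModule.MPhi A) := by
  have hplus := StandardHilbertModule.isTwoSidedIdealIn_mPhiPlus_sdiff_mPhi A
  have hminus := StandardHilbertModule.isTwoSidedIdealIn_mPhiMinus_sdiff_mPhi A
  exact ⟨hplus, hminus, hplus.isMulSemigroup_ideal, hminus.isMulSemigroup_ideal⟩
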